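/- Let $H(\mathbb C)$ be the algebra of entire functions with pointwise multiplication and the topology of uniform convergence on compact sets. For an entire function $\varphi$ of exponential type (that is, $|\varphi(z)|\le A e^{B|z|}$ for all $z\in\mathbb C$ and some constants $A,B$), let $\varphi(D)$ be the continuous linear operator on $H(\mathbb C)$ given by $$\varphi(D)f=\sum_{n=0}^{\infty}\frac{\varphi^{(n)}(0)}{n!}\,f^{(n)} .$$ A continuous linear operator $T$ on $H(\mathbb C)$ *supports a hypercyclic algebra* if there is a subalgebra $A\neq\{0\}$ of $H(\mathbb C)$ (not required to contain the constants) such that for every nonzero $f\in A$ the orbit $\{f,Tf,T^2f,\dots\}$ is dense in $H(\mathbb C)$. **Theorem.** Let $\varphi$ be a nonconstant entire function of exponential type that is not a multiple of an exponential function, i.e. not of the form $z\mapsto c\,e^{az}$ with $a,c\in\mathbb C$. Assume that $|\varphi(0)|>1$ and that there exists $w\in\mathbb C$ such that $|\varphi(tw)|\to 0$ as $t\to+\infty$ ($t$ real). Then $\varphi(D)$ supports a hypercyclic algebra. Moreover, if $\varphi(z)=P(z)e^{z}$ for some nonconstant polynomial $P\in\mathbb C[z]$ (with no condition on $|P(0)|$),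 then $\varphi(D)$ supports a hypercyclic algebra. -/

import Mathlib

open Filter Topology


noncomputable section

namespace HypercyclicAlgebra

section General

variable {X : Type*} [TopologicalSpace X] [NonUnitalNonAssocSemiring X] [Module ℂ X]

/-- A vector `x` is hypercyclic for the operator `T` if its orbit `{x, T x, T² x, …}` is dense. -/
def IsHypercyclicVector (T : X →L[ℂ] X) (x : X) : Prop :=
  Dense (Set.range fun n : ℕ => (⇑T)^[n] x)

/-- `T` supports a hypercyclic algebra: there is a nonzero (not necessarily unital) subalgebra
all of whose nonzero elements are hypercyclic vectors for `T`. -/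
def SupportsHypercyclicAlgebra (T : X →L[ℂ] X) : Prop :=
  ∃ A : NonUnitalSubalgebra ℂ X, (∃ x ∈ A, x ≠ 0) ∧
    ∀ x ∈ A, x ≠ 0 → IsHypercyclicVector T x

end General

/-- The algebra `H(ℂ)` of entire functions with pointwise multiplication.  As a subspace of
`C(ℂ, ℂ)` with the compact-open topology, it carries the topology of uniform convergence on
compact subsets of `ℂ`. -/
def EntireFunctions : Subalgebra ℂ C(ℂ, ℂ) where
  carrier := {f | Differentiable ℂ f}
  mul_mem' hf hg := Differentiable.mul hf hg
  add_mem' hf hg := Differentiable.add hf hg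
  algebraMap_mem' c := differentiable_const c

/-- Entire functions of exponential type (of any finite type). -/
structure IsEntireOfExponentialType (φ : ℂ → ℂ) : Prop where
  differentiable : Differentiable ℂ φ
  growth : ∃ A B : ℝ, ∀ z : ℂ, ‖φ z‖ ≤ A * Real.exp (B * ‖z‖)

/-- The `n`-th term `φ⁽ⁿ⁾(0) / n! * f⁽ⁿ⁾(z)` of the series for `(φ(D) f)(z)`. -/
def convolutionTerm (φ f : ℂ → ℂ) (n : ℕ) (z : ℂ) : ℂ :=
  iteratedDeriv n φ 0 / (n.factorial : ℂ) * iteratedDeriv n f z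

theorem IsEntireOfExponentialType.exists_iteratedDeriv_bound {φ : ℂ → ℂ}
    (hφ : IsEntireOfExponentialType φ) :
    ∃ A > 0, ∃ r > 0, ∀ n : ℕ, ‖iteratedDeriv n φ 0‖ ≤ A * r ^ n := by
  obtain ⟨A, B, h⟩ := hφ.growth
  have hA : 0 ≤ A := by
    have := (norm_nonneg _).trans (h 0)
    simpa using this
  refine ⟨A + 1, by linarith, Real.exp B, Real.exp_pos B, fun n => ?_⟩
  rcases Nat.eq_zero_or_pos n with rfl | hn
  · have := h 0
    simp only [norm_zero, mul_zero, Real.exp_zero, mul_one] at this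
    simp only [iteratedDeriv_zero, pow_zero, mul_one]
    linarith
  have hn' : (0 : ℝ) < n := by exact_mod_cast hn
  have key : ‖iteratedDeriv n φ 0‖ ≤ n.factorial * (A * Real.exp (B * n)) / (n : ℝ) ^ n := by
    refine Complex.norm_iteratedDeriv_le_of_forall_mem_sphere_norm_le n hn'
      hφ.differentiable.diffContOnCl fun z hz => ?_
    have hz' : ‖z‖ = n := by simpa using hz
    simpa [hz'] using h z
  have hfac : (n.factorial : ℝ) ≤ (n : ℝ) ^ n := by exact_mod_cast Nat.factorial_le_pow n
  have hpow : Real.exp (B * n) = Real.exp B ^ n := by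
    rw [← Real.exp_nat_mul, mul_comm]
  refine key.trans ?_
  rw [div_le_iff₀ (by positivity), hpow]
  have h1 : A * Real.exp B ^ n ≤ (A + 1) * Real.exp B ^ n := by
    gcongr
    linarith
  calc (n.factorial : ℝ) * (A * Real.exp B ^ n) ≤ (n : ℝ) ^ n * ((A + 1) * Real.exp B ^ n) := by
        gcongr
    _ = _ := by ring

/-- If `f` is bounded by `M` on a large enough disc, then the terms of the series for `φ(D) f`
are dominated on a smaller disc by `C * M / 2 ^ n`. -/
theorem IsEntireOfExponentialType.exists_term_bound {φ : ℂ → ℂ}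
    (hφ : IsEntireOfExponentialType φ) :
    ∃ C > 0, ∃ ρ > 0, ∀ (f : ℂ → ℂ), Differentiable ℂ f → ∀ R M : ℝ,
      (∀ z ∈ Metric.closedBall (0 : ℂ) (R + ρ), ‖f z‖ ≤ M) →
      ∀ z ∈ Metric.closedBall (0 : ℂ) R, ∀ n : ℕ,
        ‖convolutionTerm φ f n z‖ ≤ C * M * (1 / 2) ^ n := by
  obtain ⟨A, hA, r, hr, h⟩ := hφ.exists_iteratedDeriv_bound
  refine ⟨A, hA, 2 * r, by positivity, fun f hf R M hM z hz n => ?_⟩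
  have key : ‖iteratedDeriv n f z‖ ≤ n.factorial * M / (2 * r) ^ n := by
    refine Complex.norm_iteratedDeriv_le_of_forall_mem_sphere_norm_le n (by positivity)
      hf.diffContOnCl fun w hw => hM w ?_
    rw [mem_closedBall_zero_iff] at hz ⊢
    have hw' : ‖w - z‖ = 2 * r := by simpa [dist_eq_norm] using hw
    calc ‖w‖ = ‖z + (w - z)‖ := by ring_nf
      _ ≤ ‖z‖ + ‖w - z‖ := norm_add_le _ _
      _ ≤ R + 2 * r := by rw [hw']; linarith
  have hfac : (0 : ℝ) < n.factorial := by exact_mod_cast Nat.factorial_pos n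
  rw [convolutionTerm, norm_mul, norm_div, Complex.norm_natCast]
  calc ‖iteratedDeriv n φ 0‖ / n.factorial * ‖iteratedDeriv n f z‖
      ≤ A * r ^ n / n.factorial * (n.factorial * M / (2 * r) ^ n) := by
        gcongr
        exact h n
    _ = A * M * (1 / 2) ^ n := by
        rw [mul_pow, div_pow, one_pow]
        field_simp

theorem exists_bound_on_closedBall {f : ℂ → ℂ} (hf : Differentiable ℂ f) (R : ℝ) :
    ∃ M : ℝ, ∀ z ∈ Metric.closedBall (0 : ℂ) R, ‖f z‖ ≤ M :=
  (isCompact_closedBall (0 : ℂ) R).exists_bound_of_continuousOn hf.continuous.continuousOn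

theorem summable_geometric_bound (c : ℝ) : Summable fun n : ℕ => c * (1 / 2 : ℝ) ^ n :=
  (summable_geometric_of_lt_one (by norm_num) (by norm_num)).mul_left c

/-- The series defining `φ(D) f` converges at every point. -/
theorem summable_convolutionTerm {φ f : ℂ → ℂ} (hφ : IsEntireOfExponentialType φ)
    (hf : Differentiable ℂ f) (z : ℂ) : Summable fun n => convolutionTerm φ f n z := by
  obtain ⟨C, -, ρ, -, h⟩ := hφ.exists_term_bound
  obtain ⟨M, hM⟩ := exists_bound_on_closedBall hf (‖z‖ + ρ)
  exact Summable.of_norm_bounded (summable_geometric_bound (C * M))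
    (h f hf ‖z‖ M hM z (by simp))

theorem differentiable_tsum_convolutionTerm {φ f : ℂ → ℂ} (hφ : IsEntireOfExponentialType φ)
    (hf : Differentiable ℂ f) : Differentiable ℂ fun z => ∑' n, convolutionTerm φ f n z := by
  obtain ⟨C, -, ρ, -, h⟩ := hφ.exists_term_bound
  intro z
  obtain ⟨M, hM⟩ := exists_bound_on_closedBall hf (‖z‖ + 1 + ρ)
  have hd : DifferentiableOn ℂ (fun z => ∑' n, convolutionTerm φ f n z)
      (Metric.ball (0 : ℂ) (‖z‖ + 1)) := by
    refine Complex.differentiableOn_tsum_of_summable_norm (summable_geometric_bound (C * M))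
      (fun n => ?_) Metric.isOpen_ball fun n w hw =>
        h f hf (‖z‖ + 1) M hM w (Metric.ball_subset_closedBall hw) n
    have hfn : Differentiable ℂ (iteratedDeriv n f) :=
      (hf.contDiff (n := ((n + 1 : ℕ) : WithTop ℕ∞))).differentiable_iteratedDeriv n
        (by exact_mod_cast Nat.lt_succ_self n)
    exact (hfn.const_mul _).differentiableOn
  exact hd.differentiableAt (Metric.isOpen_ball.mem_nhds (by simp))

/-- The operator `φ(D)` on `H(ℂ)` as a linear map. -/
def convolutionLinearMap (φ : ℂ → ℂ) (hφ : IsEntireOfExponentialType φ) :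
    EntireFunctions →ₗ[ℂ] EntireFunctions where
  toFun f := ⟨⟨fun z => ∑' n, convolutionTerm φ f.1 n z,
    (differentiable_tsum_convolutionTerm hφ f.2).continuous⟩,
    differentiable_tsum_convolutionTerm hφ f.2⟩
  map_add' f g := by
    ext z
    change ∑' n, convolutionTerm φ (⇑f.1 + ⇑g.1) n z =
      ∑' n, convolutionTerm φ f.1 n z + ∑' n, convolutionTerm φ g.1 n z
    rw [← (summable_convolutionTerm hφ f.2 z).tsum_add (summable_convolutionTerm hφ g.2 z)]
    refine tsum_congr fun n => ?_
    have hf : Differentiable ℂ f.1 := f.2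
    have hg : Differentiable ℂ g.1 := g.2
    rw [convolutionTerm, iteratedDeriv_add hf.contDiff.contDiffAt hg.contDiff.contDiffAt, mul_add]
    rfl
  map_smul' c f := by
    ext z
    change ∑' n, convolutionTerm φ (c • ⇑f.1) n z = c * ∑' n, convolutionTerm φ f.1 n z
    rw [← tsum_mul_left]
    refine tsum_congr fun n => ?_
    have hf : Differentiable ℂ f.1 := f.2
    rw [convolutionTerm, iteratedDeriv_const_smul hf.contDiff.contDiffAt, convolutionTerm,
      smul_eq_mul]
    ring

theorem continuous_convolutionLinearMap (φ : ℂ → ℂ) (hφ : IsEntireOfExponentialType φ) :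
    Continuous (convolutionLinearMap φ hφ) := by
  have : IsTopologicalAddGroup EntireFunctions :=
    inferInstanceAs (IsTopologicalAddGroup EntireFunctions.toSubmodule.toAddSubgroup)
  refine continuous_of_continuousAt_zero (convolutionLinearMap φ hφ) ?_
  rw [ContinuousAt, map_zero, tendsto_subtype_rng,
    ContinuousMap.tendsto_iff_forall_isCompact_tendstoUniformlyOn]
  intro K hK
  obtain ⟨C, hC, ρ, hρ, h⟩ := hφ.exists_term_bound
  obtain ⟨R, hR⟩ := hK.isBounded.subset_closedBall (0 : ℂ)
  have hid : Tendsto (fun f : EntireFunctions => (f : C(ℂ, ℂ))) (𝓝 0) (𝓝 0) :=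
    continuous_subtype_val.tendsto 0
  rw [ContinuousMap.tendsto_iff_forall_isCompact_tendstoUniformlyOn] at hid
  have hunif := hid _ (isCompact_closedBall (0 : ℂ) (R + ρ))
  rw [Metric.tendstoUniformlyOn_iff] at hunif ⊢
  intro ε hε
  filter_upwards [hunif (ε / (4 * C)) (by positivity)] with f hf z hz
  have hb := h f.1 f.2 R (ε / (4 * C)) (fun w hw => by
    have := (hf w hw).le
    rwa [ContinuousMap.zero_apply, dist_zero_left] at this) z (hR hz)
  have hle : ‖∑' n, convolutionTerm φ f.1 n z‖ ≤ C * (ε / (4 * C)) * 2 :=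
    tsum_of_norm_bounded (hasSum_geometric_two.mul_left _) hb
  change dist (0 : ℂ) (∑' n, convolutionTerm φ f.1 n z) < ε
  rw [dist_zero_left]
  refine hle.trans_lt ?_
  have : C * (ε / (4 * C)) * 2 = ε / 2 := by
    field_simp
    norm_num
  linarith

/-- The convolution operator `φ(D)` on `H(ℂ)`, for `φ` entire of exponential type:
`(φ(D) f)(z) = ∑ₙ φ⁽ⁿ⁾(0) / n! * f⁽ⁿ⁾(z)`. -/
def convolutionOperator (φ : ℂ → ℂ) (hφ : IsEntireOfExponentialType φ) :
    EntireFunctions →L[ℂ] EntireFunctions where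
  toLinearMap := convolutionLinearMap φ hφ
  cont := continuous_convolutionLinearMap φ hφ

/-- The defining series of `φ(D) f` really converges to `φ(D) f`. -/
theorem hasSum_convolutionOperator (φ : ℂ → ℂ) (hφ : IsEntireOfExponentialType φ)
    (f : EntireFunctions) (z : ℂ) :
    HasSum (fun n : ℕ => iteratedDeriv n φ 0 / (n.factorial : ℂ) * iteratedDeriv n f.1 z)
      ((convolutionOperator φ hφ f).1 z) :=
  (summable_convolutionTerm hφ f.2 z).hasSum

/-- The functions `P(z) e^z`, with `P` a polynomial, are entire of exponential type. -/
theorem isEntireOfExponentialType_polynomial_mul_exp (P : Polynomial ℂ) :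
    IsEntireOfExponentialType fun z => P.eval z * Complex.exp z where
  differentiable := P.differentiable.mul Complex.differentiable_exp
  growth := by
    induction P using Polynomial.induction_on' with
    | add p q hp hq =>
      obtain ⟨A, B, h⟩ := hp
      obtain ⟨A', B', h'⟩ := hq
      have hA : 0 ≤ A := by simpa using (norm_nonneg _).trans (h 0)
      have hA' : 0 ≤ A' := by simpa using (norm_nonneg _).trans (h' 0)
      refine ⟨A + A', max B B', fun z => ?_⟩
      rw [Polynomial.eval_add, add_mul, add_mul]
      refine (norm_add_le _ _).trans (add_le_add ((h z).trans ?_) ((h' z).trans ?_))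
      · gcongr
        exact le_max_left _ _
      · gcongr
        exact le_max_right _ _
    | monomial n a =>
      refine ⟨‖a‖ * n.factorial, 2, fun z => ?_⟩
      have h1 : ‖z‖ ^ n ≤ n.factorial * Real.exp ‖z‖ := by
        have := Real.pow_div_factorial_le_exp ‖z‖ (norm_nonneg z) n
        rwa [div_le_iff₀ (by positivity), mul_comm] at this
      rw [Polynomial.eval_monomial, norm_mul, norm_mul, norm_pow]
      have h2 : Real.exp (2 * ‖z‖) = Real.exp ‖z‖ * Real.exp ‖z‖ := by
        rw [← Real.exp_add]
        ring_nf
      calc ‖a‖ * ‖z‖ ^ n * ‖Complex.exp z‖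
          ≤ ‖a‖ * (n.factorial * Real.exp ‖z‖) * Real.exp ‖z‖ := by
            gcongr
            exact Complex.norm_exp_le_exp_norm z
        _ = _ := by rw [h2]; ring

end HypercyclicAlgebra

end

/-! Write T for φ(D). By Baire category, a generic f generates a hypercyclic algebra as soon as, for
all 0 < m and all M, some u in any prescribed open set has an iterate N with T^N(u^m) near any
target and T^N(u^k) near 0 for m < k ≤ M: in p(f) the lowest power, of degree m, then dominates.

Such u are exponential sums, since T e^{γz} = φ(γ) e^{γz} and exponentials with frequencies
accumulating somewhere span a dense subspace. Take u = Σ a_γ e^{γz} + Σ β_λ κ_λ^N e^{(λ/m)z}, with γ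
near γ₀ and λ near z₀, where κ_λ^m = 1/φ(λ). If |φ(λ)| > 1, the second sum vanishes as N → ∞, so u
approaches the first. In u^m the diagonal term with frequency λ is sent by T^N to exactly β_λ^m
e^{λz}, which builds the target. Any other term of u^k, m ≤ k ≤ M, tends to 0 when |φ(sum of its
frequencies)|^m is less than the product of the |φ(λ)| over its factors of the second kind.

Mixed terms, and terms with k > m, are damped by finitely many strict inequalities at (z₀, γ₀),
which persist nearby (`exists_separating_radius`). The remaining off-diagonal terms are m-fold
products of the second kind: if the λ lie on a segment along which log|φ| is strictly convex,
Jensen's inequality damps them. Such a segment exists through z₀ once φ''φ − φ'² is nonzero there,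
and this expression vanishes identically only for multiples of exponentials. It remains to find z₀
and γ₀: z₀ near 0 and γ₀ far along the ray of w in the first case, z₀ large positive and γ₀ very
negative for P(z)e^z. -/

noncomputable section

namespace HypercyclicAlgebra

/-! ### Baire category criterion for hypercyclic algebras -/

section Criterion

variable {X : Type*} [TopologicalSpace X] [CommRing X] [Algebra ℂ X]

/-- The nonunital subalgebra of all `p(f)`, with `p` a polynomial vanishing at `0`. -/
def polynomialSubalgebra (f : X) : NonUnitalSubalgebra ℂ X where
  carrier := {x | ∃ p : Polynomial ℂ, p.coeff 0 = 0 ∧ Polynomial.aeval f p = x}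
  add_mem' := by
    rintro _ _ ⟨p, hp, rfl⟩ ⟨q, hq, rfl⟩
    exact ⟨p + q, by simp [hp, hq], by simp⟩
  zero_mem' := ⟨0, by simp, by simp⟩
  mul_mem' := by
    rintro _ _ ⟨p, hp, rfl⟩ ⟨q, hq, rfl⟩
    exact ⟨p * q, by simp [Polynomial.mul_coeff_zero, hp], by simp⟩
  smul_mem' := by
    rintro c _ ⟨p, hp, rfl⟩
    exact ⟨c • p, by simp [hp], by simp⟩

variable [IsTopologicalRing X] [ContinuousConstSMul ℂ X]

/-- If the iterates of `T` on the powers of `f` can be steered so that the power `f ^ m` comes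
close to any target while the higher powers come close to `0`, then `p(f)` is hypercyclic for every
polynomial `p` whose lowest term has degree `m`. -/
theorem isHypercyclicVector_aeval (T : X →L[ℂ] X) (f : X) (p : Polynomial ℂ)
    (hp : p ≠ 0)
    (h : ∀ V W : Set X, IsOpen V → V.Nonempty → IsOpen W → 0 ∈ W →
      ∃ N : ℕ, (⇑T)^[N] (f ^ p.natTrailingDegree) ∈ V ∧
        ∀ k, p.natTrailingDegree < k → k ≤ p.natDegree → (⇑T)^[N] (f ^ k) ∈ W) :
    IsHypercyclicVector T (Polynomial.aeval f p) := by
  set m := p.natTrailingDegree with hm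
  set M := p.natDegree with hM
  have hc : p.coeff m ≠ 0 := by
    rw [hm]; exact Polynomial.trailingCoeff_nonzero_iff_nonzero.mpr hp
  have hmM : m ≤ M := Polynomial.natTrailingDegree_le_natDegree p
  refine dense_iff_inter_open.mpr fun V' hV' hne => ?_
  obtain ⟨v, hv⟩ := hne
  -- Φ rebuilds T^N(p(f)) from T^N(f^m) and the higher T^N(f^k). It sends (v / p_m, 0) to v, so by
  -- continuity it suffices to steer the powers near that point.
  let Φ : X × (ℕ → X) → X := fun q =>
    p.coeff m • q.1 + ∑ k ∈ Finset.Ioc m M, p.coeff k • q.2 k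
  have hΦ : Continuous Φ := by fun_prop
  have h0 : Φ ((p.coeff m)⁻¹ • v, 0) ∈ V' := by simp [Φ, smul_smul, hc, hv]
  have hnhds := (hV'.preimage hΦ).mem_nhds h0
  rw [nhds_prod_eq, Filter.mem_prod_iff] at hnhds
  obtain ⟨A, hA, B, hB, hAB⟩ := hnhds
  rw [nhds_pi, Filter.mem_pi] at hB
  obtain ⟨I, hI, t, ht, htB⟩ := hB
  obtain ⟨V, hVA, hVo, hvV⟩ := mem_nhds_iff.mp hA
  have hW : (⋂ i ∈ I, t i) ∈ 𝓝 (0 : X) := (Filter.biInter_mem hI).mpr fun i _ => ht i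
  obtain ⟨W, hWA, hWo, h0W⟩ := mem_nhds_iff.mp hW
  obtain ⟨N, hN1, hN2⟩ := h V W hVo ⟨_, hvV⟩ hWo h0W
  refine ⟨_, ?_, ⟨N, rfl⟩⟩
  have hexp : (⇑T)^[N] (Polynomial.aeval f p) =
      Φ ((⇑T)^[N] (f ^ m), fun k => if k ∈ Finset.Ioc m M then (⇑T)^[N] (f ^ k) else 0) := by
    have h1 : Polynomial.aeval f p =
        p.coeff m • f ^ m + ∑ k ∈ Finset.Ioc m M, p.coeff k • f ^ k := by
      rw [Polynomial.aeval_eq_sum_range, Finset.range_eq_Ico,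
        ← Finset.sum_Ico_consecutive _ (Nat.zero_le m) (by omega : m ≤ M + 1),
        Finset.sum_eq_zero, zero_add, Finset.sum_eq_sum_Ico_succ_bot (by omega)]
      · congr 1
        exact Finset.sum_congr (by ext; simp) fun _ _ => rfl
      · intro k hk
        rw [Polynomial.coeff_eq_zero_of_lt_natTrailingDegree (Finset.mem_Ico.mp hk).2, zero_smul]
    have hpow : (⇑T)^[N] = ⇑(T.toLinearMap ^ N) := (Module.End.coe_pow _ _).symm
    rw [h1, hpow]
    simp only [map_add, map_sum, map_smul, Φ]
    congr 1
    exact Finset.sum_congr rfl fun k hk => by rw [if_pos hk]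
  simp only [hexp]
  refine hAB (Set.mk_mem_prod (hVA hN1) (htB fun i hi => ?_))
  have key : ∀ x ∈ W, x ∈ t i := fun x hx => by
    have := hWA hx
    simp only [Set.mem_iInter] at this
    exact this i hi
  simp only
  split_ifs with hmem
  · exact key _ (hN2 i (Finset.mem_Ioc.mp hmem).1 (Finset.mem_Ioc.mp hmem).2)
  · exact key _ h0W

/-- For m, M and basic open V, W, the good u form an open set, dense by hypothesis. There are
countably many such data, so Baire gives one f good for all of them at once. -/
theorem supportsHypercyclicAlgebra_of_forall_exists [BaireSpace X] [SecondCountableTopology X]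
    [Nontrivial X] [T1Space X] (T : X →L[ℂ] X)
    (h : ∀ m M : ℕ, 0 < m → ∀ U V W : Set X, IsOpen U → U.Nonempty → IsOpen V → V.Nonempty →
      IsOpen W → 0 ∈ W → ∃ u ∈ U, ∃ N : ℕ, (⇑T)^[N] (u ^ m) ∈ V ∧
        ∀ k, m < k → k ≤ M → (⇑T)^[N] (u ^ k) ∈ W) :
    SupportsHypercyclicAlgebra T := by
  let 𝓑 := TopologicalSpace.countableBasis X
  have h𝓑 : TopologicalSpace.IsTopologicalBasis 𝓑 := TopologicalSpace.isBasis_countableBasis X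
  have : Countable 𝓑 := (TopologicalSpace.countable_countableBasis X).to_subtype
  have : Countable {W : 𝓑 // (0 : X) ∈ W.1} := inferInstance
  -- The shift i.1 + 1 indexes the positive lowest degrees m; m = 0 never occurs, as the polynomials
  -- vanish at 0.
  let G : ℕ × ℕ × 𝓑 × {W : 𝓑 // (0 : X) ∈ W.1} → Set X := fun i =>
    ⋃ N : ℕ, {u | (⇑T)^[N] (u ^ (i.1 + 1)) ∈ i.2.2.1.1 ∧
      ∀ k ∈ Set.Ioc (i.1 + 1) i.2.1, (⇑T)^[N] (u ^ k) ∈ i.2.2.2.1.1}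
  have hGo : ∀ i, IsOpen (G i) := fun i => by
    refine isOpen_iUnion fun N => ?_
    have hc : ∀ k : ℕ, Continuous fun u : X => (⇑T)^[N] (u ^ k) := fun k =>
      (T.continuous.iterate N).comp (continuous_pow k)
    have hI : IsOpen (⋂ k ∈ Set.Ioc (i.1 + 1) i.2.1,
        (fun u : X => (⇑T)^[N] (u ^ k)) ⁻¹' i.2.2.2.1.1) :=
      (Set.finite_Ioc _ _).isOpen_biInter fun k _ => (h𝓑.isOpen i.2.2.2.1.2).preimage (hc k)
    convert ((h𝓑.isOpen i.2.2.1.2).preimage (hc (i.1 + 1))).inter hI using 1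
    ext u
    simp
  have hGd : ∀ i, Dense (G i) := fun i => by
    refine dense_iff_inter_open.mpr fun U hU hne => ?_
    obtain ⟨u, hu, N, h1, h2⟩ := h (i.1 + 1) i.2.1 (Nat.succ_pos _) U _ _ hU hne
      (h𝓑.isOpen i.2.2.1.2) (TopologicalSpace.nonempty_of_mem_countableBasis i.2.2.1.2)
      (h𝓑.isOpen i.2.2.2.1.2) i.2.2.2.2
    exact ⟨u, hu, Set.mem_iUnion.mpr ⟨N, h1, fun k hk => h2 k hk.1 hk.2⟩⟩
  obtain ⟨f, hf⟩ := (dense_iInter_of_isOpen hGo hGd).nonempty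
  rw [Set.mem_iInter] at hf
  have hyp : ∀ p : Polynomial ℂ, p.coeff 0 = 0 → p ≠ 0 →
      IsHypercyclicVector T (Polynomial.aeval f p) := fun p hp0 hp => by
    refine isHypercyclicVector_aeval T f p hp fun V W hV hVne hW h0 => ?_
    have hpos : p.natTrailingDegree ≠ 0 := fun h0 => by
      rcases Polynomial.natTrailingDegree_eq_zero.mp h0 with h1 | h1
      exacts [hp h1, h1 hp0]
    obtain ⟨v, hv⟩ := hVne
    obtain ⟨V', hV', -, hVV'⟩ := h𝓑.exists_subset_of_mem_open hv hV
    obtain ⟨W', hW', h0W', hWW'⟩ := h𝓑.exists_subset_of_mem_open h0 hW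
    obtain ⟨N, h1, h2⟩ := Set.mem_iUnion.mp
      (hf (p.natTrailingDegree - 1, p.natDegree, ⟨V', hV'⟩, ⟨⟨W', hW'⟩, h0W'⟩))
    simp only [Nat.sub_add_cancel (Nat.pos_of_ne_zero hpos)] at h1 h2
    exact ⟨N, hVV' h1, fun k hk hk' => hWW' (h2 k ⟨hk, hk'⟩)⟩
  refine ⟨polynomialSubalgebra f, ⟨f, ⟨Polynomial.X, by simp, by simp⟩, ?_⟩, ?_⟩
  · rintro rfl
    have h1 := hyp Polynomial.X (by simp) Polynomial.X_ne_zero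
    rw [Polynomial.aeval_X] at h1
    have h2 : (Set.range fun n : ℕ => (⇑T)^[n] (0 : X)) = {0} := by
      ext x
      simp [iterate_map_zero]
    rw [IsHypercyclicVector, h2, dense_iff_closure_eq, closure_singleton] at h1
    obtain ⟨y, hy⟩ := exists_ne (0 : X)
    exact hy (h1 ▸ Set.mem_univ y : y ∈ ({0} : Set X))
  · rintro _ ⟨p, hp0, rfl⟩ hne
    exact hyp p hp0 fun h0 => hne (by simp [h0])

end Criterion

/-! ### Topology of H(ℂ), exponentials as eigenvectors, density of their spans -/

section EntireFunctions

theorem sum_apply' {ι : Type*} {s : Finset ι} {F : ι → EntireFunctions} (z : ℂ) :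
    ∑ i ∈ s, (F i).1 z = (∑ i ∈ s, F i).1 z := by
  classical
  induction s using Finset.induction_on with
  | empty => rfl
  | insert a s ha ih =>
    rw [Finset.sum_insert ha, Finset.sum_insert ha, ih]
    rfl

/-- Weierstrass: locally uniform limits of entire functions are entire. This gives the completeness
behind the Baire property. -/
theorem isClosed_entireFunctions : IsClosed (EntireFunctions : Set C(ℂ, ℂ)) := by
  refine isClosed_of_closure_subset fun f hf => ?_
  obtain ⟨u, hu, hlim⟩ := mem_closure_iff_seq_limit.mp hf
  have h := ContinuousMap.tendsto_iff_tendstoLocallyUniformly.mp hlim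
  have := (tendstoLocallyUniformlyOn_univ.mpr h).differentiableOn
    (Eventually.of_forall fun n => (hu n : Differentiable ℂ (u n)).differentiableOn) isOpen_univ
  exact differentiableOn_univ.mp this

instance : CompleteSpace EntireFunctions := isClosed_entireFunctions.completeSpace_coe

instance : (uniformity EntireFunctions).IsCountablyGenerated :=
  Filter.comap.isCountablyGenerated _ _

instance : SecondCountableTopology EntireFunctions :=
  Topology.IsInducing.subtypeVal.secondCountableTopology

instance : IsTopologicalRing EntireFunctions :=
  inferInstanceAs (IsTopologicalRing EntireFunctions.toSubring)

theorem tendsto_entireFunctions_iff {ι : Type*} {l : Filter ι} {F : ι → EntireFunctions}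
    {f : EntireFunctions} :
    Tendsto F l (𝓝 f) ↔ ∀ R > 0, ∀ ε > 0, ∀ᶠ i in l, ∀ z : ℂ, ‖z‖ ≤ R →
      ‖(F i).1 z - f.1 z‖ < ε := by
  rw [tendsto_subtype_rng, ContinuousMap.tendsto_iff_forall_isCompact_tendstoUniformlyOn]
  constructor
  · intro h R hR ε hε
    filter_upwards [Metric.tendstoUniformlyOn_iff.mp (h _ (isCompact_closedBall (0 : ℂ) R)) ε hε]
      with i hi z hz
    have := hi z (by simpa using hz)
    rwa [dist_comm, dist_eq_norm] at this
  · intro h K hK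
    obtain ⟨R, hR0, hR⟩ := hK.isBounded.subset_closedBall_lt 0 (0 : ℂ)
    rw [Metric.tendstoUniformlyOn_iff]
    intro ε hε
    filter_upwards [h R hR0 ε hε] with i hi z hz
    rw [dist_comm, dist_eq_norm]
    exact hi z (by simpa using hR hz)

/-- The exponential function `z ↦ e^{γ z}`. -/
def expFun (γ : ℂ) : EntireFunctions :=
  ⟨⟨fun z => Complex.exp (γ * z), by fun_prop⟩,
    show Differentiable ℂ fun z => Complex.exp (γ * z) by fun_prop⟩


theorem expFun_add (γ δ : ℂ) : expFun (γ + δ) = expFun γ * expFun δ := by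
  ext z
  change Complex.exp ((γ + δ) * z) = Complex.exp (γ * z) * Complex.exp (δ * z)
  rw [add_mul, Complex.exp_add]

theorem expFun_zero : expFun 0 = 1 := by
  ext z
  change Complex.exp (0 * z) = 1
  simp

theorem expFun_sum {ι : Type*} (s : Finset ι) (γ : ι → ℂ) :
    expFun (∑ i ∈ s, γ i) = ∏ i ∈ s, expFun (γ i) := by
  classical
  induction s using Finset.induction_on with
  | empty => simp [expFun_zero]
  | insert a s ha ih => rw [Finset.sum_insert ha, Finset.prod_insert ha, expFun_add, ih]

/-- Since D^n e^{γz} = γ^n e^{γz}, the defining series is the Taylor series of φ at 0 evaluated at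
γ. -/
theorem convolutionOperator_expFun {φ : ℂ → ℂ} (hφ : IsEntireOfExponentialType φ) (γ : ℂ) :
    convolutionOperator φ hφ (expFun γ) = φ γ • expFun γ := by
  ext z
  have h1 := hasSum_convolutionOperator φ hφ (expFun γ) z
  have h2 := (Complex.hasSum_taylorSeries_of_entire hφ.differentiable 0 γ).mul_right
    (Complex.exp (γ * z))
  refine h1.unique (Eq.subst (motive := fun g => HasSum g _) (funext fun n => ?_) h2)
  have : iteratedDeriv n (expFun γ).1 z = γ ^ n * Complex.exp (γ * z) :=
    congrFun (iteratedDeriv_cexp_const_mul n γ) z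
  rw [this]
  simp only [smul_eq_mul, sub_zero]
  ring

theorem convolutionOperator_iterate_expFun {φ : ℂ → ℂ} (hφ : IsEntireOfExponentialType φ)
    (γ : ℂ) (N : ℕ) :
    (⇑(convolutionOperator φ hφ))^[N] (expFun γ) = φ γ ^ N • expFun γ := by
  induction N with
  | zero => simp
  | succ N ih =>
    rw [Function.iterate_succ_apply', ih, map_smul, convolutionOperator_expFun, smul_smul, pow_succ]

/-- The monomial `z ↦ zⁿ`. -/
def monomialFun (n : ℕ) : EntireFunctions :=
  ⟨⟨fun z => z ^ n, by fun_prop⟩, show Differentiable ℂ fun z => z ^ n by fun_prop⟩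

theorem topologicalClosure_span_monomialFun :
    (Submodule.span ℂ (Set.range monomialFun)).topologicalClosure = ⊤ := by
  rw [eq_top_iff]
  intro f _
  have hf : Differentiable ℂ f.1 := f.2
  have hp := hf.hasFPowerSeriesOnBall 0 (R := 1) one_pos
  set p := cauchyPowerSeries (⇑f.1) 0 (1 : NNReal)
  refine mem_closure_of_tendsto (b := atTop) (f := fun n : ℕ => ∑ k ∈ Finset.range n,
    p.coeff k • monomialFun k) ?_ (Eventually.of_forall
      fun n => Submodule.sum_mem _ fun k _ => Submodule.smul_mem _ _
        (Submodule.subset_span ⟨k, rfl⟩))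
  refine tendsto_entireFunctions_iff.mpr fun R hR ε hε => ?_
  obtain ⟨r, hr⟩ : ∃ r : NNReal, (r : ℝ) = R + 1 := ⟨⟨R + 1, by positivity⟩, rfl⟩
  have hu := hp.tendstoUniformlyOn (r' := r) (by simp)
  filter_upwards [Metric.tendstoUniformlyOn_iff.mp hu ε hε] with n hn z hz
  have h1 := hn z (by rw [mem_ball_zero_iff, hr]; linarith)
  rw [zero_add, dist_comm, dist_eq_norm] at h1
  have h2 : (∑ k ∈ Finset.range n, p.coeff k • monomialFun k).1 z = p.partialSum n z := by
    rw [← sum_apply']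
    refine Finset.sum_congr rfl fun k _ => ?_
    rw [FormalMultilinearSeries.apply_eq_pow_smul_coeff]
    exact mul_comm (p.coeff k) (z ^ k)
  rwa [h2]

/-- Divided differences of `δ ↦ e^{δ z}` at `γ` converge to `zⁿ e^{γ z} / n!`. -/
theorem tendsto_dividedDifference_expFun (γ : ℂ) (n : ℕ) :
    Tendsto (fun δ : ℂ => ((δ - γ) ^ n)⁻¹ • (expFun δ - ∑ k ∈ Finset.range n,
      ((δ - γ) ^ k / k.factorial) • (monomialFun k * expFun γ))) (𝓝[≠] γ)
      (𝓝 ((n.factorial : ℂ)⁻¹ • (monomialFun n * expFun γ))) := by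
  refine tendsto_entireFunctions_iff.mpr fun R hR ε hε => ?_
  set C : ℝ := Real.exp (‖γ‖ * R) * (R ^ (n + 1) * Real.exp R) with hC
  have hC0 : 0 < C := by positivity
  have hball : Metric.ball γ (min 1 (ε / C)) ∈ 𝓝[≠] γ :=
    -- With η = δ − γ, the bound ‖η‖ < 1 keeps e^{‖ηz‖} below e^R, and ‖η‖ < ε / C absorbs the one
    -- power of η left in the Taylor remainder.
    mem_nhdsWithin_of_mem_nhds (Metric.ball_mem_nhds _ (by positivity))
  filter_upwards [hball, self_mem_nhdsWithin] with δ hδ hne z hz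
  rw [Metric.mem_ball, dist_eq_norm, lt_min_iff] at hδ
  have hη : δ - γ ≠ 0 := sub_ne_zero.mpr hne
  obtain ⟨η, rfl⟩ : ∃ η, δ = γ + η := ⟨δ - γ, by ring⟩
  simp only [add_sub_cancel_left] at hδ hη ⊢
  have key : ((η ^ n)⁻¹ • (expFun (γ + η) - ∑ k ∈ Finset.range n,
      (η ^ k / k.factorial) • (monomialFun k * expFun γ))).1 z -
      ((n.factorial : ℂ)⁻¹ • (monomialFun n * expFun γ)).1 z =
      Complex.exp (γ * z) * (η ^ n)⁻¹ * (Complex.exp (η * z) - ∑ k ∈ Finset.range (n + 1),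
        (η * z) ^ k / k.factorial) := by
    have h1 : ((η ^ n)⁻¹ • (expFun (γ + η) - ∑ k ∈ Finset.range n,
        (η ^ k / k.factorial) • (monomialFun k * expFun γ))).1 z =
        (η ^ n)⁻¹ * (Complex.exp ((γ + η) * z) - ∑ k ∈ Finset.range n,
          (η ^ k / k.factorial) * (z ^ k * Complex.exp (γ * z))) := by
      have h0 : (∑ k ∈ Finset.range n, (η ^ k / k.factorial) • (monomialFun k * expFun γ)).1 z =
          ∑ k ∈ Finset.range n, (η ^ k / k.factorial) * (z ^ k * Complex.exp (γ * z)) :=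
        (sum_apply' z).symm
      rw [← h0]
      rfl
    have h2 : ((n.factorial : ℂ)⁻¹ • (monomialFun n * expFun γ)).1 z =
      (n.factorial : ℂ)⁻¹ * (z ^ n * Complex.exp (γ * z)) := rfl
    have h3 : ∑ k ∈ Finset.range n, (η ^ k / k.factorial) * (z ^ k * Complex.exp (γ * z)) =
        Complex.exp (γ * z) * ∑ k ∈ Finset.range n, (η * z) ^ k / k.factorial := by
      rw [Finset.mul_sum]
      exact Finset.sum_congr rfl fun k _ => by rw [mul_pow]; ring
    rw [h1, h2, h3, Finset.sum_range_succ, add_mul, Complex.exp_add, mul_pow]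
    have : (n.factorial : ℂ) ≠ 0 := by exact_mod_cast n.factorial_ne_zero
    field_simp
    ring
  rw [key, norm_mul, norm_mul, norm_inv, norm_pow]
  have hη' : 0 < ‖η‖ := norm_pos_iff.mpr hη
  have hηz : ‖η * z‖ ≤ ‖η‖ * R := by rw [norm_mul]; gcongr
  have hηR : ‖η‖ * R ≤ R := mul_le_of_le_one_left hR.le hδ.1.le
  have h4 : ‖Complex.exp (γ * z)‖ ≤ Real.exp (‖γ‖ * R) :=
    (Complex.norm_exp_le_exp_norm _).trans (Real.exp_le_exp.mpr (by rw [norm_mul]; gcongr))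
  have h5 := Complex.norm_exp_sub_sum_le_norm_mul_exp (η * z) (n + 1)
  have h6 : ‖η * z‖ ^ (n + 1) * Real.exp ‖η * z‖ ≤ (‖η‖ * R) ^ (n + 1) * Real.exp R := by
    gcongr
    exact hηz.trans hηR
  calc _ ≤ Real.exp (‖γ‖ * R) * (‖η‖ ^ n)⁻¹ * ((‖η‖ * R) ^ (n + 1) * Real.exp R) := by
        gcongr
        exact h5.trans h6
    _ = ‖η‖ * C := by rw [hC, mul_pow]; field_simp; ring
    _ < ε / C * C := by gcongr; exact hδ.2
    _ = ε := by field_simp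

/-- Divided differences at γ put every z^n e^{γz} in the closure, by strong induction on n.
Polynomials are dense and e^{γz} is invertible, so the closure is everything. -/
theorem topologicalClosure_span_expFun {S : Set ℂ} {γ : ℂ} (hγ : AccPt γ (𝓟 S)) :
    (Submodule.span ℂ (expFun '' S)).topologicalClosure = ⊤ := by
  set E := (Submodule.span ℂ (expFun '' S)).topologicalClosure with hE
  have hclosed : IsClosed (E : Set EntireFunctions) := Submodule.isClosed_topologicalClosure _
  have hmem : ∀ n, monomialFun n * expFun γ ∈ E := by
    intro n
    induction n using Nat.strong_induction_on with
    | _ n ih =>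
      have hfac : (n.factorial : ℂ) ≠ 0 := by exact_mod_cast n.factorial_ne_zero
      have hlim : (n.factorial : ℂ)⁻¹ • (monomialFun n * expFun γ) ∈ E := by
        have : (𝓝[≠] γ ⊓ 𝓟 S).NeBot := hγ
        refine hclosed.mem_of_tendsto
          ((tendsto_dividedDifference_expFun γ n).mono_left (inf_le_left : _ ⊓ 𝓟 S ≤ _)) ?_
        filter_upwards [mem_inf_of_right (mem_principal_self S)] with δ hδ
        have h1 : expFun δ ∈ E :=
          Submodule.le_topologicalClosure _ (Submodule.subset_span (Set.mem_image_of_mem _ hδ))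
        have h2 : ∑ k ∈ Finset.range n,
            ((δ - γ) ^ k / k.factorial) • (monomialFun k * expFun γ) ∈ E :=
          E.sum_mem fun k hk => E.smul_mem _ (ih k (Finset.mem_range.mp hk))
        have h3 := E.add_mem h1 (E.smul_mem (-1) h2)
        have h4 : ∀ a b : EntireFunctions, a - b = a + (-1 : ℂ) • b := fun a b => by
          ext z
          change a.1 z - b.1 z = a.1 z + -1 * b.1 z
          ring
        rw [← h4] at h3
        exact E.smul_mem _ h3
      have := E.smul_mem (n.factorial : ℂ) hlim
      rwa [smul_smul, mul_inv_cancel₀ hfac, one_smul] at this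
  have hcomap : ∀ g : EntireFunctions, g * expFun γ ∈ E := by
    let F : Submodule ℂ EntireFunctions := E.comap (LinearMap.mulRight ℂ (expFun γ))
    have hF : IsClosed (F : Set EntireFunctions) :=
      hclosed.preimage (continuous_id.mul continuous_const)
    have hle : (Submodule.span ℂ (Set.range monomialFun)).topologicalClosure ≤ F := by
      refine Submodule.topologicalClosure_minimal _ (Submodule.span_le.mpr ?_) hF
      rintro _ ⟨n, rfl⟩
      exact hmem n
    rw [topologicalClosure_span_monomialFun] at hle
    exact fun g => hle Submodule.mem_top
  rw [eq_top_iff]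
  intro f _
  have := hcomap (f * expFun (-γ))
  rwa [mul_assoc, ← expFun_add, neg_add_cancel, expFun_zero, mul_one] at this

end EntireFunctions

/-! ### Strict convexity of log|φ| and separation of frequencies -/

section LogConvexity

theorem hasDerivAt_log_norm {f : ℝ → ℂ} {f' : ℂ} {t : ℝ} (hf : HasDerivAt f f' t)
    (h0 : f t ≠ 0) : HasDerivAt (fun s => Real.log ‖f s‖) (f' / f t).re t := by
  have h1 := (hf.norm_sq.log (by positivity)).div_const 2
  have h2 : (fun s => Real.log (‖f s‖ ^ 2) / 2) = fun s => Real.log ‖f s‖ := by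
    ext s
    rw [Real.log_pow]
    push_cast
    ring
  rw [h2] at h1
  refine h1.congr_deriv ?_
  rw [Complex.inner, Complex.div_re, Complex.mul_re, Complex.sq_norm]
  simp only [Complex.conj_re, Complex.conj_im]
  ring

/-- Near a point at which `log φ` has nonzero second derivative, `log |φ|` is strictly convex
on a suitable segment. -/
theorem exists_strictConvexOn_log_norm {φ : ℂ → ℂ} (hφ : Differentiable ℂ φ) {z₀ : ℂ}
    (h0 : φ z₀ ≠ 0) (hW : deriv (deriv φ) z₀ * φ z₀ - deriv φ z₀ ^ 2 ≠ 0) :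
    ∃ e : ℂ, e ≠ 0 ∧ ∃ η > 0, (∀ t ∈ Set.Ioo (-η) η, φ (z₀ + (t : ℝ) * e) ≠ 0) ∧
      StrictConvexOn ℝ (Set.Ioo (-η) η) fun t : ℝ => Real.log ‖φ (z₀ + t * e)‖ := by
  have hφ' : Differentiable ℂ (deriv φ) := hφ.deriv
  have hφ'' : Differentiable ℂ (deriv (deriv φ)) := hφ'.deriv
  let F' : ℂ → ℂ := fun z => (deriv (deriv φ) z * φ z - deriv φ z * deriv φ z) / φ z ^ 2
  have hF : ∀ z, φ z ≠ 0 → HasDerivAt (fun z => deriv φ z / φ z) (F' z) z := fun z hz =>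
    (hφ' z).hasDerivAt.div (hφ z).hasDerivAt hz
  have hF'0 : F' z₀ ≠ 0 := div_ne_zero (by rwa [← sq]) (pow_ne_zero _ h0)
  -- Along direction e the second derivative of log|φ| is Re(e² F'), with F' = (log φ)''. Taking e²
  -- to be the conjugate of F'(z₀) makes it |F'(z₀)|² > 0 at z₀.
  obtain ⟨e, he⟩ := IsAlgClosed.exists_pow_nat_eq (starRingEnd ℂ (F' z₀)) (n := 2) two_pos
  have he0 : e ≠ 0 := by
    rintro rfl
    apply hF'0
    rw [zero_pow two_ne_zero, eq_comm, map_eq_zero] at he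
    exact he
  have hline : ∀ t : ℝ, HasDerivAt (fun t : ℝ => z₀ + (t : ℂ) * e) e t := fun t => by
    simpa using ((Complex.ofRealCLM.hasDerivAt (x := t)).mul_const e).const_add z₀
  have hcont : Continuous fun t : ℝ => z₀ + (t : ℂ) * e := by fun_prop
  have hev : ∀ᶠ t : ℝ in 𝓝 0, φ (z₀ + t * e) ≠ 0 ∧ 0 < (e * (F' (z₀ + t * e) * e)).re := by
    have hz : Tendsto (fun t : ℝ => z₀ + (t : ℂ) * e) (𝓝 0) (𝓝 z₀) := by
      simpa using hcont.tendsto 0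
    have hF'c : ContinuousAt F' z₀ := by
      have := hφ.continuous.continuousAt (x := z₀)
      have := hφ'.continuous.continuousAt (x := z₀)
      have := hφ''.continuous.continuousAt (x := z₀)
      exact ContinuousAt.div (by fun_prop) (by fun_prop) (pow_ne_zero _ h0)
    refine (hz.eventually (hφ.continuous.continuousAt.eventually_ne h0)).and ?_
    have h1 : ContinuousAt (fun z => (e * (F' z * e)).re) z₀ :=
      Complex.continuous_re.continuousAt.comp (by fun_prop)
    refine hz.eventually (h1.eventually (lt_mem_nhds ?_))
    have : e * (F' z₀ * e) = (Complex.normSq (F' z₀) : ℂ) := by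
      rw [Complex.normSq_eq_conj_mul_self, ← he]
      ring
    change 0 < (e * (F' z₀ * e)).re
    rw [this, Complex.ofReal_re]
    exact Complex.normSq_pos.mpr hF'0
  obtain ⟨η, hη, hball⟩ := Metric.eventually_nhds_iff.mp hev
  have hball' : ∀ t ∈ Set.Ioo (-η) η,
      φ (z₀ + (t : ℝ) * e) ≠ 0 ∧ 0 < (e * (F' (z₀ + t * e) * e)).re := fun t ht =>
    hball (by rw [dist_zero_right, Real.norm_eq_abs]; exact abs_lt.mpr ht)
  refine ⟨e, he0, η, hη, fun t ht => (hball' t ht).1, ?_⟩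
  have hd1 : ∀ t ∈ Set.Ioo (-η) η, HasDerivAt (fun t : ℝ => Real.log ‖φ (z₀ + t * e)‖)
      (e * (deriv φ (z₀ + t * e) / φ (z₀ + t * e))).re t := fun t ht => by
    have := hasDerivAt_log_norm
      (HasDerivAt.scomp t (hφ (z₀ + t * e)).hasDerivAt (hline t)) (hball' t ht).1
    exact this.congr_deriv (congrArg Complex.re (mul_div_assoc _ _ _))
  have hd2 : ∀ t ∈ Set.Ioo (-η) η,
      HasDerivAt (fun t : ℝ => (e * (deriv φ (z₀ + t * e) / φ (z₀ + t * e))).re)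
        (e * (F' (z₀ + t * e) * e)).re t := fun t ht => by
    have h1 := (HasDerivAt.scomp t (hF (z₀ + t * e) (hball' t ht).1) (hline t)).const_mul e
    have h2 := (Complex.reCLM.hasFDerivAt.comp_hasDerivAt t h1)
    exact h2.congr_deriv (congrArg (fun w => (e * w).re) (mul_comm _ _))
  refine StrictMonoOn.strictConvexOn_of_deriv (convex_Ioo _ _)
    (fun t ht => (hd1 t ht).continuousAt.continuousWithinAt) ?_
  rw [interior_Ioo]
  have hmono : StrictMonoOn
      (fun t : ℝ => (e * (deriv φ (z₀ + t * e) / φ (z₀ + t * e))).re) (Set.Ioo (-η) η) := by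
    refine strictMonoOn_of_deriv_pos (convex_Ioo _ _)
      (fun t ht => (hd2 t ht).continuousAt.continuousWithinAt) fun t ht => ?_
    rw [interior_Ioo] at ht
    rw [(hd2 t ht).deriv]
    exact (hball' t ht).2
  exact hmono.congr fun t ht => (hd1 t ht).deriv.symm

/-- Strict Jensen inequality in multiplicative form. -/
theorem norm_pow_lt_prod_of_strictConvexOn {φ : ℂ → ℂ} {z₀ e : ℂ} {s : Set ℝ}
    (h0 : ∀ t ∈ s, φ (z₀ + (t : ℝ) * e) ≠ 0)
    (hc : StrictConvexOn ℝ s fun t : ℝ => Real.log ‖φ (z₀ + t * e)‖) {m : ℕ}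
    {t : Fin m → ℝ} (ht : ∀ i, t i ∈ s) (hne : ∃ i j, t i ≠ t j) :
    ‖φ (∑ i, (z₀ + t i * e) / m)‖ ^ m < ∏ i, ‖φ (z₀ + t i * e)‖ := by
  obtain ⟨i, j, hij⟩ := hne
  have hm : (0 : ℝ) < m := by exact_mod_cast (Fin.pos i)
  have hmc : (m : ℂ) ≠ 0 := by exact_mod_cast hm.ne'
  have hw : ∑ _i : Fin m, (m : ℝ)⁻¹ = 1 := by simp [hm.ne']
  have hJ := hc.map_sum_lt (t := Finset.univ) (w := fun _ => (m : ℝ)⁻¹) (p := t)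
    (fun _ _ => by positivity) hw (fun i _ => ht i)
    ⟨i, Finset.mem_univ _, j, Finset.mem_univ _, hij⟩
  have hmem : ∑ i, (m : ℝ)⁻¹ • t i ∈ s :=
    hc.1.sum_mem (fun _ _ => by positivity) hw fun i _ => ht i
  have harg : ∑ i, (z₀ + t i * e) / m = z₀ + ((∑ i, (m : ℝ)⁻¹ • t i : ℝ) : ℂ) * e := by
    rw [← Finset.sum_div, Finset.sum_add_distrib, ← Finset.sum_mul, ← Finset.smul_sum]
    simp
    field_simp
  rw [harg]
  have hpos : ∀ i, 0 < ‖φ (z₀ + t i * e)‖ := fun i => norm_pos_iff.mpr (h0 _ (ht i))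
  rw [← Real.log_lt_log_iff (pow_pos (norm_pos_iff.mpr (h0 _ hmem)) _)
    (Finset.prod_pos fun i _ => hpos i), Real.log_pow, Real.log_prod fun i _ => (hpos i).ne']
  calc _ < (m : ℝ) * ∑ i, (m : ℝ)⁻¹ • Real.log ‖φ (z₀ + t i * e)‖ := by gcongr
    _ = _ := by rw [← Finset.smul_sum, smul_eq_mul, mul_inv_cancel_left₀ hm.ne']

/-- Finitely many patterns of left and right factors occur, and each strict inequality at (z₀, γ₀)
is an open condition. The excluded pattern, m right factors, gives equality at z₀ and needs
convexity instead. -/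
theorem exists_separating_radius {φ : ℂ → ℂ} (hφ : Continuous φ) {m M : ℕ} {z₀ γ₀ : ℂ}
    (hH : ∀ d k : ℕ, m ≤ d + k → d + k ≤ M → ¬(d = m ∧ k = 0) →
      ‖φ (d * (z₀ / m) + k * γ₀)‖ ^ m < ‖φ z₀‖ ^ d) :
    ∃ δ > 0, ∀ k, m ≤ k → k ≤ M → ∀ p : Fin k → ℂ ⊕ ℂ,
      (∀ i, Sum.elim (fun γ => dist γ γ₀ < δ) (fun z => dist z z₀ < δ) (p i)) →
      ¬(k = m ∧ ∀ i, (p i).isRight) →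
      ‖φ (∑ i, Sum.elim id (fun z => z / m) (p i))‖ ^ m <
        ∏ i, Sum.elim (fun _ => (1 : ℝ)) (fun z => ‖φ z‖) (p i) := by
  suffices h : ∀ᶠ δ : ℝ in 𝓝[>] 0, ∀ k ∈ Finset.Icc m M, ∀ s : Fin k → Bool,
      ∀ x : Fin k → ℂ, (∀ i, dist (x i) (bif s i then z₀ else γ₀) < δ) →
      ¬(k = m ∧ ∀ i, s i = true) →
      ‖φ (∑ i, bif s i then x i / m else x i)‖ ^ m < ∏ i, bif s i then ‖φ (x i)‖ else 1 by
    obtain ⟨δ, hδ, hδ0⟩ := (h.and self_mem_nhdsWithin).exists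
    refine ⟨δ, hδ0, fun k hk hk' p hp hne => ?_⟩
    convert hδ k (Finset.mem_Icc.mpr ⟨hk, hk'⟩) (fun i => (p i).isRight)
      (fun i => Sum.elim id id (p i)) (fun i => ?_) hne using 5 with i _ i
    · cases p i <;> rfl
    · cases p i <;> rfl
    · have := hp i
      cases hpi : p i <;> simpa [hpi] using this
  refine (Finset.eventually_all _).mpr fun k hk => eventually_all.mpr fun s => ?_
  obtain ⟨hk1, hk2⟩ := Finset.mem_Icc.mp hk
  by_cases hne : k = m ∧ ∀ i, s i = true
  · exact Eventually.of_forall fun δ x _ h => absurd hne h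
  let b : Fin k → ℂ := fun i => bif s i then z₀ else γ₀
  have hL : Continuous fun x : Fin k → ℂ => ‖φ (∑ i, bif s i then x i / m else x i)‖ ^ m := by
    refine ((hφ.comp (continuous_finsetSum _ fun i _ => ?_)).norm).pow m
    cases s i <;> simp only [cond_true, cond_false] <;> fun_prop
  have hR : Continuous fun x : Fin k → ℂ => ∏ i, bif s i then ‖φ (x i)‖ else 1 := by
    refine continuous_finsetProd _ fun i _ => ?_
    cases s i <;> simp only [cond_true, cond_false] <;> fun_prop
  have hbase : ‖φ (∑ i, bif s i then b i / m else b i)‖ ^ m <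
      ∏ i, bif s i then ‖φ (b i)‖ else 1 := by
    set d := (Finset.univ.filter fun i => s i = true).card with hd
    set l := (Finset.univ.filter fun i => ¬ s i = true).card with hl
    have hdl : d + l = k := by
      rw [hd, hl, Finset.card_filter_add_card_filter_not]
      simp
    have hsum : ∑ i, (bif s i then b i / m else b i) = d * (z₀ / m) + l * γ₀ := by
      have : ∀ i, (bif s i then b i / m else b i) = if s i = true then z₀ / m else γ₀ :=
        fun i => by cases h : s i <;> simp [b, h]
      simp_rw [this]
      rw [Finset.sum_ite, Finset.sum_const, Finset.sum_const, nsmul_eq_mul, nsmul_eq_mul]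
    have hprod : ∏ i, (bif s i then ‖φ (b i)‖ else 1) = ‖φ z₀‖ ^ d := by
      have : ∀ i, (bif s i then ‖φ (b i)‖ else 1) = if s i = true then ‖φ z₀‖ else 1 :=
        fun i => by cases h : s i <;> simp [b, h]
      simp_rw [this]
      rw [Finset.prod_ite, Finset.prod_const, Finset.prod_const_one, mul_one]
    rw [hsum, hprod]
    refine hH d l (by omega) (by omega) fun h => hne ⟨by omega, fun i => ?_⟩
    have := Finset.card_eq_zero.mp (hl.symm.trans h.2)
    by_contra hi
    exact absurd (Finset.mem_filter.mpr ⟨Finset.mem_univ i, hi⟩) (by rw [this]; simp)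
  obtain ⟨δ, hδ, hball⟩ := Metric.eventually_nhds_iff.mp
    ((hL.tendsto b).eventually_lt (hR.tendsto b) hbase)
  filter_upwards [Ioo_mem_nhdsGT hδ] with δ' hδ' x hx _
  refine hball ((dist_pi_lt_iff hδ).mpr fun i => (hx i).trans hδ'.2)

/-- Sets of exponents, accumulating at `γ₀` and at `z₀`, for which all but the diagonal frequencies
in the expansion of a power are damped. -/
theorem exists_separating_sets {φ : ℂ → ℂ} (hφ : Differentiable ℂ φ) {m M : ℕ}
    {z₀ γ₀ : ℂ} (h1 : 1 < ‖φ z₀‖) (hW : deriv (deriv φ) z₀ * φ z₀ - deriv φ z₀ ^ 2 ≠ 0)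
    (hH : ∀ d k : ℕ, m ≤ d + k → d + k ≤ M → ¬(d = m ∧ k = 0) →
      ‖φ (d * (z₀ / m) + k * γ₀)‖ ^ m < ‖φ z₀‖ ^ d) :
    ∃ Γ Λ : Set ℂ, AccPt γ₀ (𝓟 Γ) ∧ AccPt z₀ (𝓟 Λ) ∧ (∀ z ∈ Λ, 1 < ‖φ z‖) ∧
      ∀ k, m ≤ k → k ≤ M → ∀ p : Fin k → ℂ ⊕ ℂ, (∀ i, Sum.elim (· ∈ Γ) (· ∈ Λ) (p i)) →
      ¬(k = m ∧ ∃ z, ∀ i, p i = Sum.inr z) →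
      ‖φ (∑ i, Sum.elim id (fun z => z / m) (p i))‖ ^ m <
        ∏ i, Sum.elim (fun _ => (1 : ℝ)) (fun z => ‖φ z‖) (p i) := by
  obtain ⟨δ, hδ, hsep⟩ := exists_separating_radius hφ.continuous hH
  have hφ0 : φ z₀ ≠ 0 := norm_pos_iff.mp (one_pos.trans h1)
  obtain ⟨e, he, η, hη, hne, hconv⟩ := exists_strictConvexOn_log_norm hφ hφ0 hW
  have hline : Tendsto (fun t : ℝ => z₀ + (t : ℂ) * e) (𝓝[>] 0) (𝓝 z₀) := by
    have : Continuous fun t : ℝ => z₀ + (t : ℂ) * e := by fun_prop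
    simpa using (this.tendsto 0).mono_left nhdsWithin_le_nhds
  have hbig : ∀ᶠ z in 𝓝 z₀, 1 < ‖φ z‖ :=
    hφ.continuous.norm.continuousAt.eventually (lt_mem_nhds h1)
  let S : Set ℝ := {t | t ∈ Set.Ioo 0 η ∧ dist (z₀ + t * e) z₀ < δ ∧ 1 < ‖φ (z₀ + t * e)‖}
  have hS : S ∈ 𝓝[>] (0 : ℝ) := by
    filter_upwards [Ioo_mem_nhdsGT hη, hline.eventually (Metric.ball_mem_nhds z₀ hδ),
      hline.eventually hbig] with t h1 h2 h3 using ⟨h1, h2, h3⟩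
  have hSη : ∀ t ∈ S, t ∈ Set.Ioo (-η) η := fun t ht =>
    ⟨by have := ht.1.1; linarith, ht.1.2⟩
  -- Γ can be a full ball, but Λ must stay on the segment in direction e, where convexity is known.
  refine ⟨Metric.ball γ₀ δ, (fun t : ℝ => z₀ + (t : ℂ) * e) '' S, ?_, ?_, ?_, ?_⟩
  · have : (𝓝[≠] γ₀).NeBot := inferInstance
    rw [AccPt, inf_eq_left.mpr]
    · exact this
    · exact le_principal_iff.mpr (mem_nhdsWithin_of_mem_nhds (Metric.ball_mem_nhds _ hδ))
  · have h2 : Tendsto (fun t : ℝ => z₀ + (t : ℂ) * e) (𝓝[>] 0)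
        (𝓝[≠] z₀ ⊓ 𝓟 ((fun t : ℝ => z₀ + (t : ℂ) * e) '' S)) := by
      refine tendsto_inf.mpr ⟨tendsto_nhdsWithin_iff.mpr ⟨hline, ?_⟩, tendsto_principal.mpr ?_⟩
      · filter_upwards [self_mem_nhdsWithin] with t ht
        have : (t : ℂ) ≠ 0 := by exact_mod_cast (ne_of_gt ht)
        simp [this, he]
      · filter_upwards [hS] with t ht using ⟨t, ht, rfl⟩
    exact h2.neBot
  · rintro _ ⟨t, ht, rfl⟩
    exact ht.2.2
  · intro k hk hk' p hp hdiag
    by_cases hright : k = m ∧ ∀ i, (p i).isRight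
    · obtain ⟨rfl, hright⟩ := hright
      have : ∀ i, ∃ t ∈ S, p i = Sum.inr (z₀ + (t : ℂ) * e) := fun i => by
        have h1 := hright i
        have h2 := hp i
        cases hpi : p i with
        | inl γ => simp [hpi] at h1
        | inr z =>
          rw [hpi] at h2
          obtain ⟨t, ht, rfl⟩ := h2
          exact ⟨t, ht, rfl⟩
      choose t ht hpt using this
      simp only [hpt, Sum.elim_inr]
      refine norm_pow_lt_prod_of_strictConvexOn hne hconv (fun i => hSη _ (ht i)) ?_
      by_contra! hall
      refine hdiag ⟨rfl, ?_⟩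
      rcases Nat.eq_zero_or_pos k with rfl | hkpos
      · exact ⟨0, fun i => i.elim0⟩
      · exact ⟨z₀ + (t ⟨0, hkpos⟩ : ℂ) * e, fun i => by rw [hpt i, hall i ⟨0, hkpos⟩]⟩
    · refine hsep k hk hk' p (fun i => ?_) hright
      have h2 := hp i
      cases hpi : p i with
      | inl γ => rw [hpi] at h2; exact h2
      | inr z =>
        rw [hpi] at h2
        obtain ⟨t, ht, rfl⟩ := h2
        exact ht.2.1

end LogConvexity

/-! ### Iterates on powers of exponential sums -/

section ExponentialSums

/-- The powers of an exponential sum, and the action of the iterates of `φ(D)` on them. -/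
theorem convolutionOperator_iterate_pow_sum_expFun {φ : ℂ → ℂ}
    (hφ : IsEntireOfExponentialType φ) {ι : Type*} (J : Finset ι) (c μ : ι → ℂ) (k N : ℕ) :
    (⇑(convolutionOperator φ hφ))^[N] ((∑ i ∈ J, c i • expFun (μ i)) ^ k) =
      ∑ p ∈ Fintype.piFinset (fun _ : Fin k => J),
        ((∏ i, c (p i)) * φ (∑ i, μ (p i)) ^ N) • expFun (∑ i, μ (p i)) := by
  have hpow : (⇑(convolutionOperator φ hφ))^[N] =
      ⇑((convolutionOperator φ hφ).toLinearMap ^ N) := (Module.End.coe_pow _ _).symm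
  rw [Finset.sum_pow', hpow, map_sum]
  refine Finset.sum_congr rfl fun p _ => ?_
  rw [Finset.prod_smul, ← expFun_sum, map_smul, ← hpow, convolutionOperator_iterate_expFun,
    smul_smul]

theorem tendsto_smul_entireFunctions {c : ℕ → ℂ} {a : ℂ} (hc : Tendsto c atTop (𝓝 a))
    (f : EntireFunctions) : Tendsto (fun N => c N • f) atTop (𝓝 (a • f)) :=
  hc.smul_const f

/-- If all but the diagonal frequencies in the expansion of the `k`-th power are damped, then
the iterates of `φ(D)` on that power converge to the diagonal part, and to `0` if all are. -/
theorem tendsto_iterate_pow_sum_expFun {φ : ℂ → ℂ} (hφ : IsEntireOfExponentialType φ)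
    {ι : Type*} (J : Finset ι) (a κ μ : ι → ℂ) (k : ℕ) (D : (Fin k → ι) → Prop)
    [DecidablePred D]
    (hD : ∀ p : Fin k → ι, (∀ i, p i ∈ J) → D p → (∏ i, κ (p i)) * φ (∑ i, μ (p i)) = 1)
    (hnD : ∀ p : Fin k → ι, (∀ i, p i ∈ J) → ¬ D p →
      ‖(∏ i, κ (p i)) * φ (∑ i, μ (p i))‖ < 1) :
    Tendsto (fun N : ℕ => (⇑(convolutionOperator φ hφ))^[N]
      ((∑ i ∈ J, (a i * κ i ^ N) • expFun (μ i)) ^ k)) atTop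
      (𝓝 (∑ p ∈ Fintype.piFinset (fun _ : Fin k => J),
        if D p then (∏ i, a (p i)) • expFun (∑ i, μ (p i)) else 0)) := by
  simp_rw [convolutionOperator_iterate_pow_sum_expFun]
  refine tendsto_finsetSum _ fun p hp => ?_
  rw [Fintype.mem_piFinset] at hp
  have hcoef : ∀ N : ℕ, (∏ i, a (p i) * κ (p i) ^ N) * φ (∑ i, μ (p i)) ^ N =
      (∏ i, a (p i)) * ((∏ i, κ (p i)) * φ (∑ i, μ (p i))) ^ N := fun N => by
    rw [Finset.prod_mul_distrib, Finset.prod_pow, mul_pow, mul_assoc]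
  simp_rw [hcoef]
  split_ifs with h
  · simp [hD p hp h]
  · have h1 := (tendsto_pow_atTop_nhds_zero_of_norm_lt_one (hnD p hp h)).const_mul
      (∏ i, a (p i))
    rw [mul_zero] at h1
    have h2 := tendsto_smul_entireFunctions h1 (expFun (∑ i, μ (p i)))
    rwa [zero_smul] at h2

theorem exists_mem_finset_sum_expFun {S : Set ℂ} {γ : ℂ} (hγ : AccPt γ (𝓟 S))
    {U : Set EntireFunctions} (hU : IsOpen U) (hne : U.Nonempty) :
    ∃ (s : Finset ℂ) (c : ℂ → ℂ), (∀ z ∈ s, z ∈ S) ∧ ∑ z ∈ s, c z • expFun z ∈ U := by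
  have hd := Submodule.dense_iff_topologicalClosure_eq_top.mpr (topologicalClosure_span_expFun hγ)
  obtain ⟨f, hf, hfU⟩ := hd.exists_mem_open hU hne
  obtain ⟨l, hl, rfl⟩ := (Finsupp.mem_span_image_iff_linearCombination ℂ).mp hf
  exact ⟨l.support, l, fun z hz => hl hz, hfU⟩

theorem exists_iterate_mem {φ : ℂ → ℂ} (hφ : IsEntireOfExponentialType φ) {m M : ℕ}
    (hm : 0 < m) (hmM : m ≤ M) {z₀ γ₀ : ℂ} (h1 : 1 < ‖φ z₀‖)
    (hW : deriv (deriv φ) z₀ * φ z₀ - deriv φ z₀ ^ 2 ≠ 0)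
    (hH : ∀ d k : ℕ, m ≤ d + k → d + k ≤ M → ¬(d = m ∧ k = 0) →
      ‖φ (d * (z₀ / m) + k * γ₀)‖ ^ m < ‖φ z₀‖ ^ d)
    {U V W : Set EntireFunctions} (hU : IsOpen U) (hUne : U.Nonempty) (hV : IsOpen V)
    (hVne : V.Nonempty) (hWo : IsOpen W) (hW0 : 0 ∈ W) :
    ∃ u ∈ U, ∃ N : ℕ, (⇑(convolutionOperator φ hφ))^[N] (u ^ m) ∈ V ∧
      ∀ k, m < k → k ≤ M → (⇑(convolutionOperator φ hφ))^[N] (u ^ k) ∈ W := by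
  classical
  obtain ⟨Γ, Λ, hΓ, hΛ, hbig, hsep⟩ := exists_separating_sets hφ.differentiable h1 hW hH
  obtain ⟨A, a, hA, haU⟩ := exists_mem_finset_sum_expFun hΓ hU hUne
  obtain ⟨B, b, hB, hbV⟩ := exists_mem_finset_sum_expFun hΛ hV hVne
  choose β hβ using fun z => IsAlgClosed.exists_pow_nat_eq (b z) hm
  -- The m-th roots make the diagonal coefficient (β κ^N)^m φ(z)^N equal to b(z) for every N.
  choose κ hκ using fun z => IsAlgClosed.exists_pow_nat_eq (φ z)⁻¹ hm
  have hφB : ∀ z ∈ B, 1 < ‖φ z‖ := fun z hz => hbig z (hB z hz)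
  have hφB0 : ∀ z ∈ B, φ z ≠ 0 := fun z hz => norm_pos_iff.mp (one_pos.trans (hφB z hz))
  have hκlt : ∀ z ∈ B, ‖κ z‖ < 1 := fun z hz => by
    have h2 : ‖κ z‖ ^ m < 1 := by
      rw [← norm_pow, hκ, norm_inv]
      exact inv_lt_one_of_one_lt₀ (hφB z hz)
    exact (pow_lt_one_iff_of_nonneg (norm_nonneg _) hm.ne').mp h2
  let J : Finset (ℂ ⊕ ℂ) := A.disjSum B
  let α : ℂ ⊕ ℂ → ℂ := Sum.elim a β
  let ρ : ℂ ⊕ ℂ → ℂ := Sum.elim (fun _ => 1) κ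
  let μ : ℂ ⊕ ℂ → ℂ := Sum.elim id fun z => z / m
  have hJ : ∀ q ∈ J, Sum.elim (· ∈ Γ) (· ∈ Λ) q := by
    rintro (z | z) hz
    · exact hA z (Finset.inl_mem_disjSum.mp hz)
    · exact hB z (Finset.inr_mem_disjSum.mp hz)
  have hρ : ∀ q ∈ J, ‖ρ q‖ ^ m * Sum.elim (fun _ => (1 : ℝ)) (fun z => ‖φ z‖) q = 1 := by
    rintro (z | z) hz
    · simp [ρ]
    · have := hφB0 z (Finset.inr_mem_disjSum.mp hz)
      simp [ρ, ← norm_pow, hκ, this]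
  have hdamp : ∀ k, m ≤ k → k ≤ M → ∀ p : Fin k → ℂ ⊕ ℂ, (∀ i, p i ∈ J) →
      -- Since ‖κ z‖^m = 1 / ‖φ z‖, the m-th power of this norm is the ratio of the two sides of the
      -- separation inequality.
      ¬(k = m ∧ ∃ z, ∀ i, p i = Sum.inr z) →
      ‖(∏ i, ρ (p i)) * φ (∑ i, μ (p i))‖ < 1 := fun k hk hk' p hp hdiag => by
    have h2 := hsep k hk hk' p (fun i => hJ _ (hp i)) hdiag
    set Q := ∏ i, Sum.elim (fun _ => (1 : ℝ)) (fun z => ‖φ z‖) (p i)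
    have hQ : ‖∏ i, ρ (p i)‖ ^ m * Q = 1 := by
      rw [norm_prod, ← Finset.prod_pow, ← Finset.prod_mul_distrib]
      exact Finset.prod_eq_one fun i _ => hρ _ (hp i)
    have hpos : 0 < ‖∏ i, ρ (p i)‖ ^ m := by
      refine lt_of_le_of_ne (by positivity) fun h0 => ?_
      rw [← h0, zero_mul] at hQ
      exact zero_ne_one hQ
    refine (pow_lt_one_iff_of_nonneg (norm_nonneg _) hm.ne').mp ?_
    rw [norm_mul, mul_pow, ← hQ]
    exact mul_lt_mul_of_pos_left h2 hpos
  let u : ℕ → EntireFunctions := fun N => ∑ q ∈ J, (α q * ρ q ^ N) • expFun (μ q)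
  have hu : Tendsto u atTop (𝓝 (∑ z ∈ A, a z • expFun z)) := by
    have h2 : ∀ z ∈ B, Tendsto (fun N : ℕ => (β z * κ z ^ N) • expFun (z / m)) atTop (𝓝 0) :=
      fun z hz => by
        have h3 := (tendsto_pow_atTop_nhds_zero_of_norm_lt_one (hκlt z hz)).const_mul (β z)
        rw [mul_zero] at h3
        simpa using tendsto_smul_entireFunctions h3 (expFun (z / m))
    have h4 := (tendsto_const_nhds (x := ∑ z ∈ A, a z • expFun z)).add (tendsto_finsetSum B h2)
    rw [Finset.sum_const_zero, add_zero] at h4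
    refine h4.congr fun N => ?_
    simp [u, J, Finset.sum_disjSum, α, ρ, μ]
  have hlow : Tendsto (fun N : ℕ => (⇑(convolutionOperator φ hφ))^[N] (u N ^ m)) atTop
      (𝓝 (∑ z ∈ B, b z • expFun z)) := by
    have h2 := tendsto_iterate_pow_sum_expFun hφ J α ρ μ m
      (fun p => ∃ z, ∀ i, p i = Sum.inr z) ?_ ?_
    · convert h2 using 2
      -- Diagonal tuples are the constant ones in B; m > 0 makes z ↦ (constant tuple z) injective.
      have : Nonempty (Fin m) := ⟨⟨0, hm⟩⟩
      refine Finset.sum_of_injOn (fun z (_ : Fin m) => (Sum.inr z : ℂ ⊕ ℂ)) ?_ ?_ ?_ ?_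
      · intro z _ z' _ h
        exact Sum.inr_injective (congrFun h ⟨0, hm⟩)
      · intro z hz
        exact Finset.mem_coe.mpr (Fintype.mem_piFinset.mpr fun _ =>
          Finset.inr_mem_disjSum.mpr hz)
      · intro p hp hnot
        rw [if_neg]
        rintro ⟨z, hz⟩
        refine hnot ⟨z, ?_, (funext hz).symm⟩
        have h3 := Fintype.mem_piFinset.mp hp ⟨0, hm⟩
        rw [hz] at h3
        exact Finset.inr_mem_disjSum.mp h3
      · intro z _
        rw [if_pos ⟨z, fun _ => rfl⟩]
        have hmc : (m : ℂ) ≠ 0 := by exact_mod_cast hm.ne'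
        simp [α, μ, hβ, mul_div_cancel₀, hmc]
    · rintro p hp ⟨z, hz⟩
      have hmc : (m : ℂ) ≠ 0 := by exact_mod_cast hm.ne'
      have hzB : z ∈ B := by
        have h3 := hp ⟨0, hm⟩
        rw [hz] at h3
        exact Finset.inr_mem_disjSum.mp h3
      simp [hz, ρ, μ, hκ, mul_div_cancel₀, hmc, hφB0 z hzB]
    · exact fun p hp hdiag => hdamp m le_rfl hmM p hp fun h => hdiag h.2
  have hhigh : ∀ k ∈ Finset.Ioc m M,
      Tendsto (fun N : ℕ => (⇑(convolutionOperator φ hφ))^[N] (u N ^ k)) atTop (𝓝 0) :=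
    fun k hk => by
      obtain ⟨hk1, hk2⟩ := Finset.mem_Ioc.mp hk
      have h2 := tendsto_iterate_pow_sum_expFun hφ J α ρ μ k (fun _ => False)
        (fun _ _ h => h.elim)
        (fun p hp _ => hdamp k hk1.le hk2 p hp fun h => hk1.ne' h.1)
      simpa using h2
  obtain ⟨N, hN1, hN2, hN3⟩ := ((hu.eventually (hU.mem_nhds haU)).and
    ((hlow.eventually (hV.mem_nhds hbV)).and ((Finset.eventually_all _).mpr
      fun k hk => (hhigh k hk).eventually (hWo.mem_nhds hW0)))).exists
  exact ⟨u N, hN1, N, hN2, fun k hk hk' => hN3 k (Finset.mem_Ioc.mpr ⟨hk, hk'⟩)⟩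

/-- A sufficient condition on `φ` for `φ(D)` to support a hypercyclic algebra. -/
theorem supportsHypercyclicAlgebra_convolutionOperator {φ : ℂ → ℂ}
    (hφ : IsEntireOfExponentialType φ)
    (h : ∀ m M : ℕ, 0 < m → m ≤ M → ∃ z₀ γ₀ : ℂ, 1 < ‖φ z₀‖ ∧
      deriv (deriv φ) z₀ * φ z₀ - deriv φ z₀ ^ 2 ≠ 0 ∧
      ∀ d k : ℕ, m ≤ d + k → d + k ≤ M → ¬(d = m ∧ k = 0) →
        ‖φ (d * (z₀ / m) + k * γ₀)‖ ^ m < ‖φ z₀‖ ^ d) :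
    SupportsHypercyclicAlgebra (convolutionOperator φ hφ) := by
  refine supportsHypercyclicAlgebra_of_forall_exists (X := EntireFunctions) _
    fun m M hm U V W hU hUne hV hVne hWo hW0 => ?_
  obtain ⟨z₀, γ₀, h1, h2, h3⟩ := h m (max m M) hm (le_max_left _ _)
  obtain ⟨u, hu, N, hN, hN'⟩ :=
    exists_iterate_mem hφ hm (le_max_left _ _) h1 h2 h3 hU hUne hV hVne hWo hW0
  exact ⟨u, hu, N, hN, fun k hk hk' => hN' k hk (hk'.trans (le_max_right _ _))⟩

end ExponentialSums

/-! ### Choice of z₀ and γ₀ in the two cases -/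

section Basepoints

/-- If `(log φ)'' = 0` near a point at which `φ` does not vanish, then `φ` is a multiple of an
exponential function. -/
theorem exists_eq_mul_exp_of_eventually {φ : ℂ → ℂ} (hφ : Differentiable ℂ φ) {z₀ : ℂ}
    (h0 : φ z₀ ≠ 0) (hW : ∀ᶠ z in 𝓝 z₀, deriv (deriv φ) z * φ z - deriv φ z ^ 2 = 0) :
    ∃ c a : ℂ, ∀ z, φ z = c * Complex.exp (a * z) := by
  have hφ' : Differentiable ℂ (deriv φ) := hφ.deriv
  obtain ⟨r, hr, hball⟩ := Metric.eventually_nhds_iff_ball.mp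
    (hW.and (hφ.continuous.continuousAt.eventually_ne h0))
  have hF : ∀ z ∈ Metric.ball z₀ r, HasDerivAt (fun z => deriv φ z / φ z) 0 z := fun z hz => by
    refine ((hφ' z).hasDerivAt.div (hφ z).hasDerivAt (hball z hz).2).congr_deriv ?_
    rw [← sq, (hball z hz).1, zero_div]
  obtain ⟨a, ha⟩ := Metric.isOpen_ball.exists_is_const_of_deriv_eq_zero
    (convex_ball z₀ r).isPreconnected
    (fun z hz => (hF z hz).differentiableAt.differentiableWithinAt)
    (fun z hz => (hF z hz).deriv)
  -- The local equation φ' = aφ extends to ℂ by the identity theorem; then φ e^{−az} is constant.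
  have hode : deriv φ = fun z => a * φ z := by
    refine AnalyticOnNhd.eq_of_eventuallyEq (𝕜 := ℂ) (z₀ := z₀)
      (hφ'.differentiableOn.analyticOnNhd isOpen_univ)
      ((hφ.const_mul a).differentiableOn.analyticOnNhd isOpen_univ) ?_
    filter_upwards [Metric.ball_mem_nhds z₀ hr] with z hz
    rw [← ha z hz, div_mul_cancel₀ _ (hball z hz).2]
  have hg : ∀ z, HasDerivAt (fun z => φ z * Complex.exp (-a * z)) 0 z := fun z => by
    have h1 := (hφ z).hasDerivAt.mul (((hasDerivAt_id z).const_mul (-a)).cexp)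
    refine h1.congr_deriv ?_
    rw [hode]
    simp only [id_eq]
    ring
  refine ⟨φ 0, a, fun z => ?_⟩
  have h2 := is_const_of_deriv_eq_zero (fun z => (hg z).differentiableAt)
    (fun z => (hg z).deriv) z 0
  simp only [mul_zero, Complex.exp_zero, mul_one] at h2
  rw [← h2, mul_assoc, ← Complex.exp_add]
  simp

/-- At z₀ = 0 the inequalities hold: if k = 0 then d > m and |φ(0)| > 1; if k > 0 the left side is
below 1. They persist near 0, where some point has φ''φ − φ'² ≠ 0 because φ is not a multiple of an
exponential. -/
theorem exists_basepoints_of_tendsto_zero {φ : ℂ → ℂ} (hφ : Differentiable ℂ φ)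
    (hexp : ¬ ∃ c a : ℂ, ∀ z : ℂ, φ z = c * Complex.exp (a * z)) (h0 : 1 < ‖φ 0‖)
    {w : ℂ} (hw : Tendsto (fun t : ℝ => ‖φ ((t : ℂ) * w)‖) atTop (𝓝 0)) {m : ℕ} (hm : 0 < m)
    (M : ℕ) :
    ∃ z₀ γ₀ : ℂ, 1 < ‖φ z₀‖ ∧ deriv (deriv φ) z₀ * φ z₀ - deriv φ z₀ ^ 2 ≠ 0 ∧
      ∀ d k : ℕ, m ≤ d + k → d + k ≤ M → ¬(d = m ∧ k = 0) →
        ‖φ (d * (z₀ / m) + k * γ₀)‖ ^ m < ‖φ z₀‖ ^ d := by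
  obtain ⟨t, ht⟩ := eventually_atTop.mp (hw.eventually (gt_mem_nhds one_pos))
  -- Nonnegativity gives k t₀ ≥ t for every k ≥ 1, so one t₀ serves all k.
  set t₀ := max t 0
  have hbase : ∀ d k : ℕ, m ≤ d + k → ¬(d = m ∧ k = 0) →
      ‖φ (d * (0 / m) + k * (t₀ * w))‖ ^ m < ‖φ 0‖ ^ d := fun d k hdk hne => by
    rcases Nat.eq_zero_or_pos k with rfl | hk
    · simpa using pow_lt_pow_right₀ h0 (by omega : m < d)
    · have h1 : t ≤ k * t₀ := by
        have h2 : (1 : ℝ) ≤ k := by exact_mod_cast hk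
        have h3 : 0 ≤ t₀ := le_max_right _ _
        have h4 : t ≤ t₀ := le_max_left _ _
        nlinarith
      have h2 := ht _ h1
      push_cast at h2
      rw [zero_div, mul_zero, zero_add, ← mul_assoc]
      exact (pow_lt_one₀ (norm_nonneg _) h2 hm.ne').trans_le (one_le_pow₀ h0.le)
  have hev : ∀ᶠ z in 𝓝 (0 : ℂ), ∀ q ∈ Finset.range (M + 1) ×ˢ Finset.range (M + 1),
      m ≤ q.1 + q.2 → ¬(q.1 = m ∧ q.2 = 0) →
        ‖φ (q.1 * (z / m) + q.2 * (t₀ * w))‖ ^ m < ‖φ z‖ ^ q.1 := by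
    refine (Finset.eventually_all _).mpr fun q _ => ?_
    by_cases h : m ≤ q.1 + q.2 ∧ ¬(q.1 = m ∧ q.2 = 0)
    · have hL : Continuous fun z : ℂ => ‖φ (q.1 * (z / m) + q.2 * (t₀ * w))‖ ^ m :=
        ((hφ.continuous.comp (by fun_prop)).norm).pow m
      have hR : Continuous fun z : ℂ => ‖φ z‖ ^ q.1 := hφ.continuous.norm.pow _
      filter_upwards [(hL.tendsto 0).eventually_lt (hR.tendsto 0) (hbase q.1 q.2 h.1 h.2)]
        with z hz _ _ using hz
    · exact Eventually.of_forall fun z h1 h2 => absurd ⟨h1, h2⟩ h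
  have hfreq : ∃ᶠ z in 𝓝 (0 : ℂ), deriv (deriv φ) z * φ z - deriv φ z ^ 2 ≠ 0 := fun h =>
    hexp (exists_eq_mul_exp_of_eventually hφ (norm_pos_iff.mp (one_pos.trans h0))
      (h.mono fun z hz => not_not.mp hz))
  obtain ⟨z, hz1, hz2, hz3⟩ := (hfreq.and_eventually (hev.and
    (hφ.continuous.norm.continuousAt.eventually (lt_mem_nhds h0)))).exists
  refine ⟨z, t₀ * w, hz3, hz1, fun d k h1 h2 h3 => hz2 (d, k) ?_ h1 h3⟩
  simp only [Finset.mem_product, Finset.mem_range]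
  omega

open Polynomial in
-- With degree n and leading coefficient a, equality would force n(n − 1)a² = n²a².
theorem derivative_derivative_mul_sub_sq_ne_zero {P : ℂ[X]} (hP : 0 < P.natDegree) :
    derivative (derivative P) * P - derivative P ^ 2 ≠ 0 := fun h => by
  have h1 := congrArg leadingCoeff (sub_eq_zero.mp h)
  simp only [leadingCoeff_mul, leadingCoeff_pow, leadingCoeff_derivative,
    natDegree_derivative] at h1
  have h2 : P.leadingCoeff ≠ 0 := leadingCoeff_ne_zero.mpr (ne_zero_of_natDegree_gt hP)
  have h3 : (P.natDegree : ℂ) ≠ 0 := by exact_mod_cast hP.ne'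
  rw [Nat.cast_sub hP] at h1
  have h4 : P.leadingCoeff ^ 2 * P.natDegree = 0 := by linear_combination -h1
  exact mul_ne_zero (pow_ne_zero 2 h2) h3 h4

open Polynomial in
theorem deriv_polynomial_mul_exp (P : ℂ[X]) :
    deriv (fun z => P.eval z * Complex.exp z) =
      fun z => (P + derivative P).eval z * Complex.exp z := by
  ext z
  refine (((P.hasDerivAt z).mul (Complex.hasDerivAt_exp z)).congr_deriv ?_).deriv
  rw [eval_add]
  ring

open Polynomial in
theorem tendsto_polynomial_mul_exp_atBot (P : ℂ[X]) :
    Tendsto (fun x : ℝ => P.eval (x : ℂ) * Complex.exp x) atBot (𝓝 0) := by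
  simp_rw [eval_eq_sum_range, Finset.sum_mul]
  rw [← Finset.sum_const_zero (s := Finset.range (P.natDegree + 1))]
  refine tendsto_finsetSum _ fun i _ => ?_
  have h1 : Tendsto (fun x : ℝ => (x : ℂ) ^ i * Complex.exp x) atBot (𝓝 0) := by
    rw [tendsto_zero_iff_norm_tendsto_zero]
    refine ((Real.tendsto_pow_mul_exp_neg_atTop_nhds_zero i).comp
      tendsto_neg_atBot_atTop).congr' ?_
    filter_upwards [eventually_le_atBot 0] with x hx
    simp [Complex.norm_exp, abs_of_nonpos hx]
  simpa [mul_assoc] using h1.const_mul (P.coeff i)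

open Polynomial in
theorem eventually_norm_eval_pow_lt {P : ℂ[X]} (hP : 0 < P.natDegree) (c : ℂ) {m d : ℕ}
    (hmd : m < d) :
    ∀ᶠ s : ℝ in atTop, ‖P.eval (c * s)‖ ^ m < ‖P.eval (s : ℂ)‖ ^ d := by
  have hP0 : P ≠ 0 := ne_zero_of_natDegree_gt hP
  have hdeg : ((P.comp (C c * X)) ^ m).degree < (P ^ d).degree := by
    refine degree_lt_degree (lt_of_le_of_lt natDegree_pow_le ?_)
    rw [natDegree_pow]
    have h1 : (P.comp (C c * X)).natDegree ≤ P.natDegree := by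
      refine natDegree_comp_le.trans ?_
      have h2 : (C c * X : ℂ[X]).natDegree ≤ 1 := by
        simpa using natDegree_C_mul_X_pow_le c 1
      nlinarith
    calc m * (P.comp (C c * X)).natDegree ≤ m * P.natDegree := by gcongr
      _ < d * P.natDegree := by gcongr
  have hlim := RCLike.tendsto_ofReal_atTop_cobounded ℂ
  have h1 := (isLittleO_cobounded_of_degree_lt hdeg).bound (one_half_pos (α := ℝ))
  have h2 := (Bornology.le_cofinite ℂ) (eventually_cofinite_not_isRoot hP0)
  filter_upwards [hlim.eventually h1, hlim.eventually h2] with s hs1 hs2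
  have hpos : 0 < ‖P.eval (s : ℂ)‖ ^ d := pow_pos (norm_pos_iff.mpr hs2) d
  simp only [eval_pow, eval_comp, eval_mul, eval_C, eval_X, norm_pow] at hs1
  refine hs1.trans_lt ?_
  change 1 / 2 * ‖P.eval (s : ℂ)‖ ^ d < _
  linarith

open Polynomial in
-- For k = 0 the exponential factors on both sides cancel, leaving a comparison of polynomials of
-- different degree, settled for large s = z₀. For k > 0 the decay of P(x)e^x at −∞ is used, with y
-- = γ₀ chosen after s.
theorem exists_basepoints_polynomial_mul_exp {P : ℂ[X]} (hP : 0 < P.natDegree) {m : ℕ}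
    (hm : 0 < m) (M : ℕ) {φ : ℂ → ℂ} (hφ : φ = fun z => P.eval z * Complex.exp z) :
    ∃ z₀ γ₀ : ℂ, 1 < ‖φ z₀‖ ∧ deriv (deriv φ) z₀ * φ z₀ - deriv φ z₀ ^ 2 ≠ 0 ∧
      ∀ d k : ℕ, m ≤ d + k → d + k ≤ M → ¬(d = m ∧ k = 0) →
        ‖φ (d * (z₀ / m) + k * γ₀)‖ ^ m < ‖φ z₀‖ ^ d := by
  have hmc : (m : ℂ) ≠ 0 := by exact_mod_cast hm.ne'
  have hlim := RCLike.tendsto_ofReal_atTop_cobounded ℂ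
  have hlarge : ∀ᶠ s : ℝ in atTop, 1 < ‖P.eval (s : ℂ)‖ :=
    (P.tendsto_norm_atTop (natDegree_pos_iff_degree_pos.mp hP)
      (tendsto_norm_cobounded_atTop.comp hlim)).eventually_gt_atTop 1
  have hroot : ∀ᶠ s : ℝ in atTop,
      ¬ (derivative (derivative P) * P - derivative P ^ 2).IsRoot (s : ℂ) :=
    hlim.eventually ((Bornology.le_cofinite ℂ)
      (eventually_cofinite_not_isRoot (derivative_derivative_mul_sub_sq_ne_zero hP)))
  have hpow : ∀ᶠ s : ℝ in atTop, ∀ d ∈ Finset.Ioc m M,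
      ‖P.eval ((d / m : ℂ) * s)‖ ^ m < ‖P.eval (s : ℂ)‖ ^ d :=
    (Finset.eventually_all _).mpr fun d hd =>
      eventually_norm_eval_pow_lt hP _ (Finset.mem_Ioc.mp hd).1
  obtain ⟨s, hs0, hs1, hs2, hs3⟩ :=
    ((eventually_ge_atTop 0).and (hlarge.and (hroot.and hpow))).exists
  have hφs : 1 < ‖φ s‖ := by
    rw [hφ, norm_mul, Complex.norm_exp, Complex.ofReal_re]
    exact one_lt_mul_of_lt_of_le hs1 (Real.one_le_exp hs0)
  have hneg : ∀ᶠ y : ℝ in atBot, ∀ q ∈ Finset.range (M + 1) ×ˢ Finset.Ioc 0 M,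
      ‖φ (q.1 * (s / m) + q.2 * y)‖ < 1 := by
    refine (Finset.eventually_all _).mpr fun q hq => ?_
    have hq2 : 0 < q.2 := (Finset.mem_Ioc.mp (Finset.mem_product.mp hq).2).1
    have h1 : Tendsto (fun y : ℝ => (q.1 * (s / m) + q.2 * y : ℝ)) atBot atBot :=
      tendsto_atBot_add_const_left _ _
        (tendsto_id.const_mul_atBot (by exact_mod_cast hq2 : (0 : ℝ) < q.2))
    have h2 := ((tendsto_polynomial_mul_exp_atBot P).comp h1).norm
    rw [norm_zero] at h2
    filter_upwards [h2.eventually (gt_mem_nhds one_pos)] with y hy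
    rw [hφ]
    simpa using hy
  obtain ⟨y, hy⟩ := hneg.exists
  refine ⟨s, y, hφs, ?_, fun d k h1 h2 h3 => ?_⟩
  · have h4 : deriv (deriv φ) s * φ s - deriv φ s ^ 2 =
        (derivative (derivative P) * P - derivative P ^ 2).eval (s : ℂ) *
          Complex.exp s ^ 2 := by
      rw [hφ, deriv_polynomial_mul_exp, deriv_polynomial_mul_exp]
      simp only [eval_add, eval_sub, eval_mul, eval_pow, derivative_add]
      ring
    rw [h4]
    exact mul_ne_zero hs2 (pow_ne_zero _ (Complex.exp_ne_zero _))
  · rcases Nat.eq_zero_or_pos k with rfl | hk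
    · have h4 := hs3 d (Finset.mem_Ioc.mpr ⟨by omega, by omega⟩)
      have h5 : (d : ℂ) * ((s : ℂ) / m) + (0 : ℕ) * y = d / m * s := by
        push_cast
        ring
      -- This exact cancellation is why no condition on |P(0)| is needed.
      have h6 : ‖Complex.exp (d / m * s)‖ ^ m = ‖Complex.exp s‖ ^ d := by
        rw [← norm_pow, ← norm_pow, ← Complex.exp_nat_mul, ← Complex.exp_nat_mul]
        congr 2
        field_simp
      rw [h5, hφ]
      simp only [norm_mul, mul_pow]
      rw [h6]
      exact mul_lt_mul_of_pos_right h4 (pow_pos (norm_pos_iff.mpr (Complex.exp_ne_zero _)) _)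
    · have h4 := hy (d, k) (Finset.mem_product.mpr
        ⟨Finset.mem_range.mpr (by omega), Finset.mem_Ioc.mpr ⟨hk, by omega⟩⟩)
      exact (pow_lt_one₀ (norm_nonneg _) h4 hm.ne').trans_le (one_le_pow₀ hφs.le)

end Basepoints

end HypercyclicAlgebra

end

theorem theorem1p1 :
    (∀ (φ : ℂ → ℂ) (hφ : HypercyclicAlgebra.IsEntireOfExponentialType φ),
      (¬ ∃ c : ℂ, ∀ z : ℂ, φ z = c) →
      (¬ ∃ c a : ℂ, ∀ z : ℂ, φ z = c * Complex.exp (a * z)) →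
      1 < ‖φ 0‖ →
      (∃ w : ℂ, Tendsto (fun t : ℝ => ‖φ ((t : ℂ) * w)‖) atTop (𝓝 0)) →
      HypercyclicAlgebra.SupportsHypercyclicAlgebra
        (HypercyclicAlgebra.convolutionOperator φ hφ)) ∧
    (∀ P : Polynomial ℂ, 0 < P.natDegree →
      HypercyclicAlgebra.SupportsHypercyclicAlgebra
        (HypercyclicAlgebra.convolutionOperator (fun z => P.eval z * Complex.exp z)
          (HypercyclicAlgebra.isEntireOfExponentialType_polynomial_mul_exp P))) := by
  refine ⟨fun φ hφ _ hexp h0 ⟨w, hw⟩ => ?_, fun P hP => ?_⟩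
  · exact HypercyclicAlgebra.supportsHypercyclicAlgebra_convolutionOperator hφ fun m M hm _ =>
      HypercyclicAlgebra.exists_basepoints_of_tendsto_zero hφ.differentiable hexp h0 hw hm M
  · exact HypercyclicAlgebra.supportsHypercyclicAlgebra_convolutionOperator _ fun m M hm _ =>
      HypercyclicAlgebra.exists_basepoints_polynomial_mul_exp hP hm M rfl
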